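/- Let $k$ be an algebraically closed field of prime characteristic $p$, and let $L$ be a semisimple restricted Lie algebra over $k$ (semisimple: the radical is zero, i.e. there is no nonzero solvable ideal), of arbitrary dimension, with $p$-th power map $x\mapsto x^{[p]}$ and basis $\{e_i\mid i\in I\}$. Let $\mathfrak g$ be either the current algebra $L[x]=L\otimes_k k[x]$ or the loop algebra $L(x)=L\otimes_k k[x,x^{-1}]$, with bracket $[a\otimes x^r,b\otimes x^s]=[a,b]\otimes x^{r+s}$; put $\mathbb I=\mathbb N=\{0,1,2,\dots\}$ in the first case and $\mathbb I=\mathbb Z$ in the second, and $e_{ir}=e_i\otimes x^r$ for $i\in I$, $r\in\mathbb I$. Then $\mathfrak g$ has a unique structure of restricted Lie algebra with $e_{ir}^{[p]}=e_i^{[p]}\otimes x^{rp}$ for all $i\in I$, $r\in\mathbb I$. With this structure, the center $Z(\mathfrak g)$ of the universal enveloping algebra $U(\mathfrak g)$ is equal to the $p$-center $Z_p(\mathfrak g)$, the subalgebra of $U(\mathfrak g)$ generated by the elements $y^p-y^{[p]}$ for all $y\in\mathfrak g$. Moreover, $Z(\mathfrak g)$ is freely generated, as a commutative $k$-algebra,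 by $$\{\,e_{ir}^p-e_{ir}^{[p]}\mid i\in I,\ r\in\mathbb I\,\},$$ that is, these elements are central, algebraically independent over $k$ (when indexed by $I\times\mathbb I$), and generate $Z(\mathfrak g)$. -/

import Mathlib

open scoped TensorProduct Polynomial LaurentPolynomial

noncomputable section

/-- Jacobson's polynomials `s_i(x, y)`, for `1 ≤ i ≤ p - 1`: in the Lie algebra `k[t] ⊗ L`, the
coefficient of `t ^ (i - 1)` in `ad (t x + y) ^ (p - 1) (x)` is `i • s_i(x, y)`. -/
def jacobsonTerm (k : Type*) {L : Type*} [Field k] [LieRing L] [LieAlgebra k L]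
    (p i : ℕ) (x y : L) : L :=
  (i : k)⁻¹ • TensorProduct.lid k L
    ((Polynomial.lcoeff k (i - 1)).rTensor L
      (((LieAlgebra.ad k (k[X] ⊗[k] L)
        ((Polynomial.X : k[X]) ⊗ₜ[k] x + (1 : k[X]) ⊗ₜ[k] y)) ^ (p - 1))
          ((1 : k[X]) ⊗ₜ[k] x)))

/-- A restricted structure (a `p`-th power map `x ↦ x ^ [p]`) on a Lie algebra `L` over a field `k`
(of characteristic `p`), in the sense of Jacobson. -/
@[ext]
structure RestrictedStructure (k L : Type*) [Field k] [LieRing L] [LieAlgebra k L] (p : ℕ) where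
  /-- The `p`-th power map. -/
  pow : L → L
  /-- `ad (x ^ [p]) = (ad x) ^ p`. -/
  ad_pow : ∀ x : L, LieAlgebra.ad k L (pow x) = (LieAlgebra.ad k L x) ^ p
  /-- `(c x) ^ [p] = c ^ p x ^ [p]`. -/
  pow_smul : ∀ (c : k) (x : L), pow (c • x) = c ^ p • pow x
  /-- `(x + y) ^ [p] = x ^ [p] + y ^ [p] + ∑ s_i(x, y)`. -/
  pow_add : ∀ x y : L,
    pow (x + y) = pow x + pow y + ∑ i ∈ Finset.Ico 1 p, jacobsonTerm k p i x y

/-- The element `x ^ p - x ^ [p]` of the universal enveloping algebra. -/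
def pCentralElement {k L : Type*} [Field k] [LieRing L] [LieAlgebra k L] {p : ℕ}
    (P : RestrictedStructure k L p) (x : L) : UniversalEnvelopingAlgebra k L :=
  UniversalEnvelopingAlgebra.ι k x ^ p - UniversalEnvelopingAlgebra.ι k (P.pow x)

/-- The `p`-center: the subalgebra of the universal enveloping algebra that is generated by the
elements `x ^ p - x ^ [p]`, for all `x`. -/
def pCenter {k L : Type*} [Field k] [LieRing L] [LieAlgebra k L] {p : ℕ}
    (P : RestrictedStructure k L p) : Subalgebra k (UniversalEnvelopingAlgebra k L) :=
  Algebra.adjoin k (Set.range (pCentralElement P))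

/-- The center of the `k`-algebra `A` is freely generated by the family `a`: the `a j` lie in the
center, are algebraically independent over `k`, and generate the center as a `k`-algebra. -/
def CenterFreelyGeneratedBy (k : Type*) {A ι : Type*} [Field k] [Ring A] [Algebra k A]
    (a : ι → A) : Prop :=
  ∃ z : ι → Subalgebra.center k A, (∀ j, (z j : A) = a j) ∧
    AlgebraicIndependent k z ∧ Algebra.adjoin k (Set.range z) = ⊤

end

noncomputable section

attribute [local instance] LieRing.ofAssociativeRing

/-! ### Jacobson's formula in an associative algebra of characteristic p -/

section Jacobson

/-! Everything rests on the injectivity of `ad`. A trivial radical forces a trivial center of L, and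
A ⊗ L inherits this coordinate by coordinate. Two restricted structures on such a Lie algebra agree,
and one exists as soon as (ad y)^p is inner for a spanning set of y, by Jacobson's formula; for y =
a ⊗ x the element a^p ⊗ x^[p] serves.

For the center, filter U(𝔤) by the length of products and pass to symbols in the polynomial ring on
a basis, using the form of PBW in `exists_toMvPolynomial`. Commutation with y ∈ 𝔤 becomes the
derivation extending ad y, so the symbol of a central element is an invariant f. Only finitely many
variables occur in f. Bracketing with x^s ⊗ a, where s moves a chosen power of x away from all those
variables, and reading off the coefficients of the new variables shows that the partial derivatives
of f at that power assemble into central elements of L, hence vanish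
(`pderiv_eq_zero_of_derivation_eq_zero`). So f is a polynomial in the p-th powers of the variables.

The central elements e_{ir}^p - e_{ir}^[p] have exactly these p-th powers as symbols. Subtracting a
polynomial in them lowers the degree of a central element, so they generate the center by induction;
they are independent because substituting p-th powers for the variables is injective. -/

theorem neg_one_pow_mul_choose_prime_sub_one (k : Type*) [CommRing k] (p : ℕ) [Fact p.Prime]
    [CharP k p] (m : ℕ) (hm : m ≤ p - 1) : (-1 : k) ^ m * ((p - 1).choose m : k) = 1 := by
  have hp := (Fact.out : p.Prime)
  induction m with
  | zero => simp
  | succ m ih =>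
    have h1 : ((p.choose (m + 1) : ℕ) : k) = 0 := by
      rw [CharP.cast_eq_zero_iff k p]
      exact hp.dvd_choose_self (by omega) (by omega)
    have h2 : p.choose (m + 1) = (p - 1).choose m + (p - 1).choose (m + 1) := by
      obtain ⟨q, rfl⟩ : ∃ q, p = q + 1 := ⟨p - 1, by have := hp.pos; omega⟩
      simp [Nat.choose_succ_succ]
    rw [h2] at h1
    push_cast at h1
    have := ih (by omega)
    rw [pow_succ]
    linear_combination this - (-1) ^ m * h1

/-- A division-free form of (x - y)^(p-1) = (x^p - y^p)/(x - y): the signed binomial coefficients of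
p - 1 are all 1 modulo p. -/
theorem Commute.sub_pow_prime_sub_one {A : Type*} [Ring A] (k : Type*) [CommRing k] [Algebra k A]
    (p : ℕ) [Fact p.Prime] [CharP k p] {x y : A} (h : Commute x y) :
    (x - y) ^ (p - 1) = ∑ i ∈ Finset.range p, x ^ i * y ^ (p - 1 - i) := by
  have hp := (Fact.out : p.Prime)
  have hc : Commute (-y) x := h.symm.neg_left
  rw [sub_eq_neg_add, hc.add_pow, ← Finset.sum_range_reflect,
    Nat.sub_add_cancel hp.one_le]
  refine Finset.sum_congr rfl fun i hi => ?_
  have hi' : i ≤ p - 1 := by have := Finset.mem_range.1 hi; omega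
  have e : p - 1 - (p - 1 - i) = i := by omega
  have hk := congrArg (algebraMap k A)
    (neg_one_pow_mul_choose_prime_sub_one k p (p - 1 - i) (by omega))
  simp only [map_mul, map_pow, map_neg, map_one, map_natCast] at hk
  rw [e, neg_pow]
  have hcomm := (Nat.cast_commute ((p - 1).choose (p - 1 - i))
    (y ^ (p - 1 - i) * x ^ i)).eq
  rw [mul_assoc, mul_assoc, ← mul_assoc (y ^ _), ← hcomm, ← mul_assoc, hk, one_mul,
    (h.pow_pow i (p - 1 - i)).eq]

theorem Polynomial.derivative_pow_eq_sum {A : Type*} [Semiring A] (w : A[X]) (n : ℕ) :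
    Polynomial.derivative (w ^ n) =
      ∑ i ∈ Finset.range n, w ^ i * Polynomial.derivative w * w ^ (n - 1 - i) := by
  induction n with
  | zero => simp
  | succ n ih =>
    rw [pow_succ, Polynomial.derivative_mul, ih, Finset.sum_range_succ, Finset.sum_mul]
    congr 1
    · refine Finset.sum_congr rfl fun i hi => ?_
      have : n + 1 - 1 - i = n - 1 - i + 1 := by have := Finset.mem_range.1 hi; omega
      rw [this, pow_succ, mul_assoc]
    · simp

/-- Left and right multiplication by w commute. The right side is the shape of the noncommutative
derivative of w^p, which thereby becomes an iterated commutator. -/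
theorem mulLeft_sub_mulRight_pow_prime_sub_one {A : Type*} [Ring A] (k : Type*) [CommRing k]
    [Algebra k A] (p : ℕ) [Fact p.Prime] [CharP k p] (w v : A) :
    ((LinearMap.mulLeft k w - LinearMap.mulRight k w) ^ (p - 1)) v =
      ∑ i ∈ Finset.range p, w ^ i * v * w ^ (p - 1 - i) := by
  rw [Commute.sub_pow_prime_sub_one k p (LinearMap.commute_mulLeft_right w w)]
  simp [LinearMap.sum_apply, Module.End.mul_apply, mul_assoc]

theorem mulLeft_sub_mulRight_pow_prime {A : Type*} [Ring A] (k : Type*) [Field k]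
    [Algebra k A] (p : ℕ) [Fact p.Prime] [CharP k p] (w : A) :
    (LinearMap.mulLeft k w - LinearMap.mulRight k w) ^ p =
      LinearMap.mulLeft k (w ^ p) - LinearMap.mulRight k (w ^ p) := by
  -- Endomorphisms of the zero ring do not have characteristic p.
  cases subsingleton_or_nontrivial A
  · exact LinearMap.ext fun v => Subsingleton.elim _ _
  have : CharP (Module.End k A) p := charP_of_injective_algebraMap
    (FaithfulSMul.algebraMap_injective k (Module.End k A)) p
  rw [sub_pow_char_of_commute p (LinearMap.commute_mulLeft_right w w)]
  simp

variable {k L A : Type*} [Field k] [LieRing L] [LieAlgebra k L] [Ring A] [Algebra k A]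

/-- The map `k[X] ⊗ L → A[X]`, `g ⊗ x ↦ g * f x`, that extends a linear map `f : L → A`. -/
def polynomialExtension (f : L →ₗ[k] A) : k[X] ⊗[k] L →ₗ[k] A[X] :=
  TensorProduct.lift ((LinearMap.mul k A[X]).compl₁₂
    (Polynomial.mapAlg k A).toLinearMap ((Polynomial.CAlgHom (R := k)).toLinearMap ∘ₗ f))

@[simp]
theorem polynomialExtension_tmul (f : L →ₗ[k] A) (g : k[X]) (x : L) :
    polynomialExtension f (g ⊗ₜ x) = g.map (algebraMap k A) * Polynomial.C (f x) := by
  simp [polynomialExtension, Polynomial.mapAlg_eq_map]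

theorem polynomialExtension_lie (f : L →ₗ[k] A) (hf : ∀ x y, f ⁅x, y⁆ = f x * f y - f y * f x)
    (u v : k[X] ⊗[k] L) : polynomialExtension f (LieAlgebra.ad k (k[X] ⊗[k] L) u v) =
      polynomialExtension f u * polynomialExtension f v -
        polynomialExtension f v * polynomialExtension f u := by
  -- Polynomials with coefficients in k are central in A[X], although A need not be commutative.
  have hc (g : k[X]) (q : A[X]) : Commute (g.map (algebraMap k A)) q := by
    have := Algebra.commutes (A := A[X]) (R := k)
    induction g using Polynomial.induction_on' with
    | add a b ha hb => rw [Polynomial.map_add]; exact ha.add_left hb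
    | monomial n a =>
      rw [Polynomial.map_monomial, ← Polynomial.C_mul_X_pow_eq_monomial]
      exact Commute.mul_left (this a q) ((Polynomial.commute_X q).pow_left n)
  induction u using TensorProduct.induction_on with
  | zero => simp
  | add a b ha hb => rw [map_add, LinearMap.add_apply, map_add, ha, hb, map_add]; noncomm_ring
  | tmul g x =>
    induction v using TensorProduct.induction_on with
    | zero => simp
    | add a b ha hb => rw [map_add, map_add, ha, hb, map_add]; noncomm_ring
    | tmul h y =>
      have hb : LieAlgebra.ad k (k[X] ⊗[k] L) (g ⊗ₜ x) (h ⊗ₜ y) = (g * h) ⊗ₜ ⁅x, y⁆ :=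
        LieAlgebra.ExtendScalars.bracket_tmul k k[X] L L g h x y
      rw [hb]
      simp only [polynomialExtension_tmul, hf, Polynomial.map_mul, map_sub, map_mul, mul_sub]
      congr 1
      · rw [mul_assoc, mul_assoc]
        congr 1
        rw [← mul_assoc, (hc h _).eq, mul_assoc]
      · rw [(hc g _).eq, mul_assoc, mul_assoc]
        congr 1
        rw [(hc g _).eq, mul_assoc, ← (hc g (Polynomial.C (f x))).eq]

theorem coeff_polynomialExtension (f : L →ₗ[k] A) (n : ℕ) (u : k[X] ⊗[k] L) :
    (polynomialExtension f u).coeff n =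
      f (TensorProduct.lid k L ((Polynomial.lcoeff k n).rTensor L u)) := by
  induction u using TensorProduct.induction_on with
  | zero => simp
  | add a b ha hb => simp only [map_add, Polynomial.coeff_add, ha, hb]
  | tmul g x => simp [Algebra.smul_def]

/-- Jacobson's formula for the `p`-th power of a sum. -/
theorem jacobson_formula (p : ℕ) [Fact p.Prime] [CharP k p] (f : L →ₗ[k] A)
    (hf : ∀ x y, f ⁅x, y⁆ = f x * f y - f y * f x) (x y : L) :
    f (x + y) ^ p = f x ^ p + f y ^ p + ∑ i ∈ Finset.Ico 1 p, f (jacobsonTerm k p i x y) := by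
  have hp := (Fact.out : p.Prime)
  -- Since w has constant derivative f x, the derivative of w^p is (ad w)^(p-1)(f x). This
  -- identifies the coefficients of w^p in degrees 1 ≤ i < p, where i is invertible, with the
  -- Jacobson terms; the formula is the value at X = 1.
  set w : A[X] := Polynomial.X * Polynomial.C (f x) + Polynomial.C (f y) with hw
  have hwd : w.natDegree ≤ 1 := by
    refine Polynomial.natDegree_add_le_of_degree_le ?_ (by simp)
    exact Polynomial.natDegree_mul_le.trans (by
      simpa using Polynomial.natDegree_X_le)
  have had (n : ℕ) : polynomialExtension f
      (((LieAlgebra.ad k (k[X] ⊗[k] L)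
        ((Polynomial.X : k[X]) ⊗ₜ[k] x + (1 : k[X]) ⊗ₜ[k] y)) ^ n) ((1 : k[X]) ⊗ₜ[k] x)) =
      ((LinearMap.mulLeft k w - LinearMap.mulRight k w) ^ n) (Polynomial.C (f x)) := by
    induction n with
    | zero => simp
    | succ n ih =>
      rw [pow_succ', pow_succ', Module.End.mul_apply, Module.End.mul_apply, ← ih,
        polynomialExtension_lie f hf]
      simp [hw]
  have hterm (i : ℕ) (hi : i ∈ Finset.Ico 1 p) : (w ^ p).coeff i = f (jacobsonTerm k p i x y) := by
    obtain ⟨hi1, hi2⟩ := Finset.mem_Ico.1 hi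
    have hi0 : (i : k) ≠ 0 := fun h => by
      have := Nat.le_of_dvd hi1 ((CharP.cast_eq_zero_iff k p i).1 h)
      omega
    have hder : Polynomial.derivative w = Polynomial.C (f x) := by simp [hw]
    have h1 := Polynomial.coeff_derivative (w ^ p) (i - 1)
    rw [Polynomial.derivative_pow_eq_sum, hder,
      ← mulLeft_sub_mulRight_pow_prime_sub_one k p, ← had, coeff_polynomialExtension,
      Nat.sub_add_cancel hi1] at h1
    have h2 : ((i - 1 : ℕ) : A) + 1 = algebraMap k A i := by
      rw [map_natCast, ← Nat.cast_add_one, Nat.sub_add_cancel hi1]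
    rw [jacobsonTerm, map_smul, h1, h2, ← Algebra.commutes, ← Algebra.smul_def, smul_smul,
      inv_mul_cancel₀ hi0, one_smul]
  have h0 : (w ^ p).coeff 0 = f y ^ p := by
    have := map_pow (Polynomial.constantCoeff (R := A)) w p
    simpa [hw] using this
  have hpp : (w ^ p).coeff p = f x ^ p := by
    have := Polynomial.coeff_pow_of_natDegree_le hwd (m := p)
    simpa [hw, Polynomial.coeff_C] using this
  have h1 : (w ^ p).eval 1 = f (x + y) ^ p := by
    have := map_pow (Polynomial.eval₂RingHom' (RingHom.id A) 1 (fun a => Commute.one_right _)) w p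
    simpa [hw, Polynomial.eval₂RingHom', ← Polynomial.eval.eq_1] using this
  have hd : (w ^ p).natDegree < p + 1 :=
    Nat.lt_succ_of_le ((Polynomial.natDegree_pow_le_of_le p hwd).trans (by simp))
  rw [← h1, Polynomial.eval_eq_sum_range' hd, Finset.sum_range_succ,
    ← Finset.sum_range_add_sum_Ico _ hp.one_le, ← Finset.sum_congr rfl hterm]
  simp [h0, hpp]
  abel

end Jacobson

/-! ### Restricted structures and central elements of the enveloping algebra -/

section Restricted

variable {k L : Type*} [Field k] [LieRing L] [LieAlgebra k L]

theorem LieAlgebra.ad_injective_of_hasTrivialRadical [LieAlgebra.HasTrivialRadical k L] :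
    Function.Injective (LieAlgebra.ad k L) := by
  rw [← LieHom.ker_eq_bot, LieAlgebra.ad_ker_eq_self_module_ker,
    LieAlgebra.self_module_ker_eq_center]
  exact LieAlgebra.center_eq_bot k L

theorem ad_toLinearMap_lie (x y : L) : (LieAlgebra.ad k L).toLinearMap ⁅x, y⁆ =
    (LieAlgebra.ad k L).toLinearMap x * (LieAlgebra.ad k L).toLinearMap y -
      (LieAlgebra.ad k L).toLinearMap y * (LieAlgebra.ad k L).toLinearMap x :=
  (LieAlgebra.ad k L).map_lie x y

theorem RestrictedStructure.eq_of_ad_injective {p : ℕ}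
    (h : Function.Injective (LieAlgebra.ad k L)) (Q Q' : RestrictedStructure k L p) : Q = Q' := by
  ext x
  exact h (by rw [Q.ad_pow, Q'.ad_pow])

/-- On a Lie algebra with trivial center, a restricted structure exists as soon as the elements
whose `p`-th power under `ad` is inner span the Lie algebra. -/
theorem exists_restrictedStructure (p : ℕ) [Fact p.Prime] [CharP k p]
    (h : Function.Injective (LieAlgebra.ad k L)) (s : Set L) (hs : Submodule.span k s = ⊤)
    (hps : ∀ x ∈ s, ∃ y, LieAlgebra.ad k L y = LieAlgebra.ad k L x ^ p) :
    Nonempty (RestrictedStructure k L p) := by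
  have hp := (Fact.out : p.Prime)
  have hj (x y : L) := jacobson_formula p (LieAlgebra.ad k L).toLinearMap ad_toLinearMap_lie x y
  simp only [LieHom.coe_toLinearMap] at hj
  -- By Jacobson's formula in the endomorphism algebra, the x for which (ad x)^p is inner form a
  -- subspace.
  have hex (x : L) : ∃ y, LieAlgebra.ad k L y = LieAlgebra.ad k L x ^ p := by
    have hx : x ∈ Submodule.span k s := hs ▸ Submodule.mem_top
    induction hx using Submodule.span_induction with
    | mem x hx => exact hps x hx
    | zero => exact ⟨0, by simp [hp.ne_zero]⟩
    | add x y _ _ hx hy =>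
      obtain ⟨x', hx'⟩ := hx
      obtain ⟨y', hy'⟩ := hy
      refine ⟨x' + y' + ∑ i ∈ Finset.Ico 1 p, jacobsonTerm k p i x y, ?_⟩
      rw [hj, map_add, map_add, hx', hy', map_sum]
    | smul c x _ hx =>
      obtain ⟨x', hx'⟩ := hx
      exact ⟨c ^ p • x', by rw [map_smul, map_smul, hx', smul_pow]⟩
  choose pow hpow using hex
  refine ⟨⟨pow, hpow, fun c x => h ?_, fun x y => h ?_⟩⟩
  · rw [map_smul, hpow, hpow, map_smul, smul_pow]
  · rw [hpow, hj, map_add, map_add, hpow, hpow, map_sum]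

theorem UniversalEnvelopingAlgebra.ι_lie (x y : L) :
    UniversalEnvelopingAlgebra.ι k ⁅x, y⁆ =
      UniversalEnvelopingAlgebra.ι k x * UniversalEnvelopingAlgebra.ι k y -
      UniversalEnvelopingAlgebra.ι k y * UniversalEnvelopingAlgebra.ι k x :=
  (UniversalEnvelopingAlgebra.ι k (L := L)).map_lie x y

/-- By the universal property, the inclusion of the generated subalgebra has a right inverse, so it
is onto. -/
theorem UniversalEnvelopingAlgebra.adjoin_range_ι :
    Algebra.adjoin k (Set.range (UniversalEnvelopingAlgebra.ι k (L := L))) = ⊤ := by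
  set S := Algebra.adjoin k (Set.range (UniversalEnvelopingAlgebra.ι k (L := L))) with hS
  let f : L →ₗ⁅k⁆ S :=
    { toFun x := ⟨UniversalEnvelopingAlgebra.ι k x, Algebra.subset_adjoin ⟨x, rfl⟩⟩
      map_add' x y := Subtype.ext (map_add _ x y)
      map_smul' c x := Subtype.ext (map_smul _ c x)
      map_lie' {x y} := Subtype.ext (UniversalEnvelopingAlgebra.ι_lie x y) }
  have h : S.val.comp (UniversalEnvelopingAlgebra.lift k f) = AlgHom.id k _ := by
    apply UniversalEnvelopingAlgebra.hom_ext
    ext x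
    exact congrArg Subtype.val (UniversalEnvelopingAlgebra.lift_ι_apply k f x)
  refine eq_top_iff.2 fun u _ => ?_
  rw [← AlgHom.id_apply (R := k) u, ← h]
  exact (UniversalEnvelopingAlgebra.lift k f u).2

/-- The elements `x ^ p - x ^ [p]` are central. -/
theorem pCentralElement_mem_center {p : ℕ} [Fact p.Prime] [CharP k p]
    (Q : RestrictedStructure k L p) (x : L) :
    pCentralElement Q x ∈ Subalgebra.center k (UniversalEnvelopingAlgebra k L) := by
  -- For n = p the commutator operator becomes the commutator with (ι x)^p, while (ad x)^p is ad of
  -- x^[p]; both powers thus have the same commutator with ι y.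
  have hn (x y : L) (n : ℕ) : UniversalEnvelopingAlgebra.ι k ((LieAlgebra.ad k L x ^ n) y) =
      ((LinearMap.mulLeft k (UniversalEnvelopingAlgebra.ι k x) -
        LinearMap.mulRight k (UniversalEnvelopingAlgebra.ι k x)) ^ n)
          (UniversalEnvelopingAlgebra.ι k y) := by
    induction n with
    | zero => simp
    | succ n ih =>
      rw [pow_succ', pow_succ', Module.End.mul_apply, Module.End.mul_apply, ← ih,
        LieAlgebra.ad_apply, UniversalEnvelopingAlgebra.ι_lie]
      simp
  have hc (y : L) : UniversalEnvelopingAlgebra.ι k y * pCentralElement Q x =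
      pCentralElement Q x * UniversalEnvelopingAlgebra.ι k y := by
    have h1 := hn x y p
    rw [← Q.ad_pow, mulLeft_sub_mulRight_pow_prime, LieAlgebra.ad_apply,
      UniversalEnvelopingAlgebra.ι_lie] at h1
    simp only [LinearMap.sub_apply, LinearMap.mulLeft_apply, LinearMap.mulRight_apply] at h1
    rw [pCentralElement, sub_mul, mul_sub]
    rw [← sub_eq_zero] at h1 ⊢
    rw [← h1]
    abel
  rw [Subalgebra.mem_center_iff]
  intro u
  have hu : u ∈ Algebra.adjoin k (Set.range (UniversalEnvelopingAlgebra.ι k (L := L))) := by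
    rw [UniversalEnvelopingAlgebra.adjoin_range_ι]; trivial
  induction hu using Algebra.adjoin_induction with
  | mem u hu => obtain ⟨y, rfl⟩ := hu; exact hc y
  | algebraMap c => exact Algebra.commutes c _
  | add u v _ _ hu hv => rw [add_mul, mul_add, hu, hv]
  | mul u v _ _ hu hv => rw [mul_assoc, hv, ← mul_assoc, hu, mul_assoc]

end Restricted

/-! ### The filtration by length of products -/

section ListFiltration

variable {k A B J : Type*} [CommRing k] [Ring A] [Algebra k A] [Ring B] [Algebra k B]

/-- The span of the products of fewer than `n` members of the family `a`. -/
def listFiltration (k : Type*) {A J : Type*} [CommRing k] [Ring A] [Algebra k A]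
    (a : J → A) (n : ℕ) : Submodule k A :=
  Submodule.span k {u | ∃ l : List J, l.length < n ∧ (l.map a).prod = u}

namespace listFiltration

variable {a : J → A}

theorem prod_mem {l : List J} {n : ℕ} (h : l.length < n) :
    (l.map a).prod ∈ listFiltration k a n :=
  Submodule.subset_span ⟨l, h, rfl⟩

theorem mono {m n : ℕ} (h : m ≤ n) : listFiltration k a m ≤ listFiltration k a n :=
  Submodule.span_mono fun _ ⟨l, hl, hu⟩ => ⟨l, hl.trans_le h, hu⟩

theorem le_iff {n : ℕ} {S : Submodule k A} :
    listFiltration k a n ≤ S ↔ ∀ l : List J, l.length < n → (l.map a).prod ∈ S := by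
  rw [listFiltration, Submodule.span_le]
  exact ⟨fun h l hl => h ⟨l, hl, rfl⟩, fun h _ ⟨l, hl, hu⟩ => hu ▸ h l hl⟩

variable (k a) in
theorem eq_bot : listFiltration k a 0 = ⊥ :=
  le_bot_iff.1 (le_iff.2 fun _ h => absurd h (Nat.not_lt_zero _))

theorem apply_mem (j : J) : a j ∈ listFiltration k a 2 := by
  simpa using prod_mem (k := k) (a := a) (l := [j]) (n := 2) (by simp)

theorem one_mem {n : ℕ} (h : 0 < n) : (1 : A) ∈ listFiltration k a n :=
  prod_mem (l := []) h

theorem sum_smul_mem (c : J →₀ k) : (c.sum fun j r => r • a j) ∈ listFiltration k a 2 :=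
  Submodule.sum_mem _ fun j _ => Submodule.smul_mem _ _ (apply_mem j)

/-- Two linear maps that agree on short products agree on the filtration. -/
theorem eqOn {M : Type*} [AddCommGroup M] [Module k M] {n : ℕ} {f g : A →ₗ[k] M}
    (h : ∀ l : List J, l.length < n → f (l.map a).prod = g (l.map a).prod) {u : A}
    (hu : u ∈ listFiltration k a n) : f u = g u :=
  (le_iff.2 h : listFiltration k a n ≤ LinearMap.eqLocus f g) hu

/-- The bound is strict: level n + 1 means degree at most n, and level 0 is zero. Lengths below m
and n add up to at most m + n - 2, whence the N + 1. -/
theorem mul_mem {m n N : ℕ} {u v : A} (hu : u ∈ listFiltration k a m)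
    (hv : v ∈ listFiltration k a n) (h : m + n ≤ N + 1) : u * v ∈ listFiltration k a N := by
  have h1 : listFiltration k a m ≤
      (listFiltration k a N).comap (LinearMap.mulRight k v) := le_iff.2 fun l hl => by
    have h2 : listFiltration k a n ≤
        (listFiltration k a N).comap (LinearMap.mulLeft k (l.map a).prod) :=
      le_iff.2 fun l' hl' => by
        have := prod_mem (k := k) (a := a) (l := l ++ l') (n := N) (by simp; omega)
        simpa using this
    exact h2 hv
  exact h1 hu

theorem pow_mem {u : A} (hu : u ∈ listFiltration k a 2) (n : ℕ) :
    u ^ n ∈ listFiltration k a (n + 1) := by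
  induction n with
  | zero => exact pow_zero u ▸ one_mem (by omega)
  | succ n ih => exact pow_succ u n ▸ mul_mem ih hu (by omega)

theorem map_list_prod_mem {I : Type*} (f : I → A) (hf : ∀ i, f i ∈ listFiltration k a 2)
    (l : List I) : (l.map f).prod ∈ listFiltration k a (l.length + 1) := by
  induction l with
  | nil => exact one_mem (by simp)
  | cons i l ih => simpa using mul_mem (hf i) ih (by omega)

/-- If the members of the family commute modulo lower terms, then so do the factors of a product. -/
theorem prod_sub_prod_mem_of_perm
    (hc : ∀ i j, a i * a j - a j * a i ∈ listFiltration k a 2) {l l' : List J}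
    (h : l.Perm l') : (l.map a).prod - (l'.map a).prod ∈ listFiltration k a l.length := by
  induction h with
  | nil => simp
  | cons j h ih =>
    simpa [mul_sub] using mul_mem (apply_mem j) ih (by omega)
  | swap i j l =>
    have := mul_mem (hc j i) (prod_mem (k := k) (a := a) (l := l) (lt_add_one _))
      (N := l.length + 2) (by omega)
    simpa [sub_mul, mul_assoc] using this
  | trans h1 h2 ih1 ih2 =>
    rw [← h1.length_eq] at ih2
    simpa using add_mem ih1 ih2

end listFiltration

end ListFiltration

/-! ### The degree filtration of a polynomial ring -/

section MvPolynomialFiltration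

open MvPolynomial

variable {k σ τ : Type*} [CommRing k]

theorem MvPolynomial.isHomogeneous_list_prod_X (l : List σ) :
    ((l.map X).prod : MvPolynomial σ k).IsHomogeneous l.length := by
  induction l with
  | nil => simpa using isHomogeneous_one σ k
  | cons j l ih =>
    simpa [add_comm] using (isHomogeneous_X k j).mul ih

theorem MvPolynomial.homogeneousComponent_list_prod_X (l : List σ) (n : ℕ) :
    homogeneousComponent n ((l.map X).prod : MvPolynomial σ k) =
      if n = l.length then (l.map X).prod else 0 :=
  homogeneousComponent_of_mem (isHomogeneous_list_prod_X l)

theorem MvPolynomial.homogeneousComponent_eq_zero_of_mem_listFiltration {n : ℕ}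
    {f : MvPolynomial σ k} (hf : f ∈ listFiltration k X n) : homogeneousComponent n f = 0 :=
  listFiltration.eqOn (g := 0) (fun l hl => by
    rw [homogeneousComponent_list_prod_X, if_neg hl.ne', LinearMap.zero_apply]) hf

theorem MvPolynomial.aeval_mem_listFiltration (φ : σ → MvPolynomial τ k)
    (hφ : ∀ i, φ i ∈ listFiltration k X 2) {n : ℕ} {f : MvPolynomial σ k}
    (hf : f ∈ listFiltration k X n) : aeval φ f ∈ listFiltration k X n := by
  have : listFiltration k X n ≤ (listFiltration k X n).comap (aeval φ).toLinearMap :=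
    listFiltration.le_iff.2 fun l hl => by
      have := listFiltration.mono (show l.length + 1 ≤ n from hl)
        (listFiltration.map_list_prod_mem φ hφ l)
      simpa [map_list_prod, Function.comp_def] using this
  exact this hf

theorem Derivation.mem_listFiltration (D : Derivation k (MvPolynomial σ k) (MvPolynomial σ k))
    (hD : ∀ i, D (X i) ∈ listFiltration k X 2) {n : ℕ} {f : MvPolynomial σ k}
    (hf : f ∈ listFiltration k X n) : D f ∈ listFiltration k X n := by
  have : listFiltration k X n ≤ (listFiltration k X n).comap D.toLinearMap :=
    listFiltration.le_iff.2 fun l hl => by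
      refine listFiltration.mono (show l.length + 1 ≤ n from hl) ?_
      clear hl
      change D _ ∈ _
      induction l with
      | nil => simp
      | cons i l ih =>
        simp only [List.map_cons, List.prod_cons, D.leibniz, smul_eq_mul, List.length_cons]
        refine add_mem (listFiltration.mul_mem (listFiltration.apply_mem i) ih (by omega)) ?_
        rw [mul_comm]
        exact listFiltration.mul_mem (hD i) (listFiltration.prod_mem (lt_add_one _)) (by omega)
  exact this hf

end MvPolynomialFiltration

/-! ### A Poincaré–Birkhoff–Witt theorem from the adjoint representation -/

section PBW

open MvPolynomial

/-- The linear forms in the polynomial ring on a basis. -/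
def Module.Basis.toMvPolynomial {k M σ : Type*} [CommRing k] [AddCommGroup M] [Module k M]
    (b : Module.Basis σ k M) : M →ₗ[k] MvPolynomial σ k :=
  b.constr k X

variable {k M σ : Type*} [CommRing k] [AddCommGroup M] [Module k M]

@[simp]
theorem Module.Basis.toMvPolynomial_self (b : Module.Basis σ k M) (i : σ) :
    b.toMvPolynomial (b i) = X i := b.constr_basis k X i

theorem Module.Basis.toMvPolynomial_mem (b : Module.Basis σ k M) (x : M) :
    b.toMvPolynomial x ∈ listFiltration k X 2 := by
  rw [Module.Basis.toMvPolynomial, Module.Basis.constr_apply]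
  exact listFiltration.sum_smul_mem _

/-- The derivation of the polynomial ring on a basis that extends a linear endomorphism. -/
def Module.Basis.derivation (b : Module.Basis σ k M) (f : Module.End k M) :
    Derivation k (MvPolynomial σ k) (MvPolynomial σ k) :=
  mkDerivation k fun i => b.toMvPolynomial (f (b i))

theorem Module.Basis.derivation_toMvPolynomial (b : Module.Basis σ k M) (f : Module.End k M)
    (x : M) : b.derivation f (b.toMvPolynomial x) = b.toMvPolynomial (f x) := by
  have : (b.derivation f).toLinearMap ∘ₗ b.toMvPolynomial = b.toMvPolynomial ∘ₗ f :=
    b.ext fun i => by simp [Module.Basis.derivation]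
  exact LinearMap.congr_fun this x

@[simp]
theorem Module.Basis.derivation_X (b : Module.Basis σ k M) (f : Module.End k M) (i : σ) :
    b.derivation f (X i) = b.toMvPolynomial (f (b i)) := mkDerivation_X _ _ _

theorem Module.Basis.derivation_add (b : Module.Basis σ k M) (f g : Module.End k M) :
    b.derivation (f + g) = b.derivation f + b.derivation g :=
  MvPolynomial.derivation_ext fun i => by simp

theorem Module.Basis.derivation_smul (b : Module.Basis σ k M) (r : k) (f : Module.End k M) :
    b.derivation (r • f) = r • b.derivation f :=
  MvPolynomial.derivation_ext fun i => by simp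

theorem Module.Basis.derivation_lie (b : Module.Basis σ k M) (f g : Module.End k M)
    (q : MvPolynomial σ k) : b.derivation (f * g - g * f) q =
      b.derivation f (b.derivation g q) - b.derivation g (b.derivation f q) := by
  rw [← Derivation.commutator_apply]
  refine DFunLike.congr_fun (MvPolynomial.derivation_ext fun i => ?_) q
  simp [Derivation.commutator_apply, Module.Basis.derivation_toMvPolynomial]

variable {k g J : Type*} [Field k] [LieRing g] [LieAlgebra k g]

/-- The Poincaré–Birkhoff–Witt theorem for Lie algebras with trivial center, in the form of a linear
map from the enveloping algebra to the polynomial ring that sends products of basis elements to the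
corresponding monomials modulo lower terms. It comes from the action of the Lie algebra on
the symmetric algebra of its endomorphism space `M`, in which `x` acts as the sum of the derivation
that extends left multiplication by `ad x` on `M` and of multiplication by `ad x ∈ M`. -/
theorem UniversalEnvelopingAlgebra.exists_toMvPolynomial
    (h : Function.Injective (LieAlgebra.ad k g)) (b : Module.Basis J k g) :
    ∃ Ψ : UniversalEnvelopingAlgebra k g →ₗ[k] MvPolynomial J k, ∀ l : List J,
      Ψ (l.map fun j => UniversalEnvelopingAlgebra.ι k (b j)).prod - (l.map X).prod ∈
        listFiltration k X l.length := by
  let c : g →ₗ[k] Module.End k g := (LieAlgebra.ad k g).toLinearMap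
  obtain ⟨π, hπ⟩ := LinearMap.exists_leftInverse_of_injective c (LinearMap.ker_eq_bot.2 h)
  let β := Module.Basis.ofVectorSpace k (Module.End k g)
  have hc (x y : g) : c ⁅x, y⁆ = c x * c y - c y * c x := ad_toLinearMap_lie x y
  let D (x : g) := β.derivation (LinearMap.mul k _ (c x))
  let s := β.toMvPolynomial
  have hD (x y : g) : D x (s (c y)) = s (c x * c y) := β.derivation_toMvPolynomial _ _
  have hadd (x y : g) (q) : D (x + y) q = D x q + D y q := by
    simp only [D, map_add, Module.Basis.derivation_add, Derivation.add_apply]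
  have hsmul (r : k) (x : g) (q) : D (r • x) q = r • D x q := by
    simp only [D, map_smul, Module.Basis.derivation_smul, Derivation.smul_apply]
  have hDD (x y : g) (q) : D ⁅x, y⁆ q = D x (D y q) - D y (D x q) := by
    rw [← Module.Basis.derivation_lie]
    simp only [D, hc]
    congr 2
  let ρ : g →ₗ⁅k⁆
      Module.End k (MvPolynomial (Module.Basis.ofVectorSpaceIndex k (Module.End k g)) k) :=
    { toFun x := (D x).toLinearMap + LinearMap.mulLeft k (s (c x))
      map_add' x y := LinearMap.ext fun q => by
        change D (x + y) q + s (c (x + y)) * q = (D x q + s (c x) * q) + (D y q + s (c y) * q)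
        rw [hadd, map_add, map_add, add_mul]
        abel
      map_smul' r x := LinearMap.ext fun q => by
        change D (r • x) q + s (c (r • x)) * q = r • (D x q + s (c x) * q)
        rw [hsmul, map_smul, map_smul, smul_add, smul_mul_assoc]
      -- The map `c` is a cocycle for left multiplication: c x * c y - c y * c x = c ⁅x, y⁆. The
      -- cross terms D x (s (c y)) and D y (s (c x)) supply exactly this; the other mixed terms
      -- cancel by commutativity.
      map_lie' {x y} := by
        refine LinearMap.ext fun q => ?_
        rw [LieRing.of_associative_ring_bracket]
        change D ⁅x, y⁆ q + s (c ⁅x, y⁆) * q =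
          (D x (D y q + s (c y) * q) + s (c x) * (D y q + s (c y) * q)) -
          (D y (D x q + s (c x) * q) + s (c y) * (D x q + s (c x) * q))
        rw [hDD, hc, map_sub, ← hD, ← hD]
        simp only [map_add, Derivation.leibniz, smul_eq_mul]
        ring }
  have hρ (x : g) (q) : ρ x q = D x q + s (c x) * q := rfl
  let Φ := UniversalEnvelopingAlgebra.lift k ρ
  -- A retraction of `ad` carries the polynomial ring on the endomorphisms back to the one on 𝔤
  -- without raising degrees.
  let θ := aeval (R := k) fun i => b.toMvPolynomial (π (β i))
  have hθ (m) : θ (s m) = b.toMvPolynomial (π m) := by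
    have : θ.toLinearMap ∘ₗ s = b.toMvPolynomial ∘ₗ π := β.ext fun i => by simp [θ, s]
    exact LinearMap.congr_fun this m
  -- The derivation part of the action preserves degree and only the multiplication raises it, so
  -- the leading term of a product applied to 1 is the product of the linear forms.
  have key (l : List J) : Φ (l.map fun j => UniversalEnvelopingAlgebra.ι k (b j)).prod 1 -
      (l.map fun j => s (c (b j))).prod ∈ listFiltration k X l.length := by
    induction l with
    | nil => simp
    | cons j l ih =>
      have hP := listFiltration.map_list_prod_mem (k := k) (a := X) (fun j => s (c (b j)))
        (fun j => β.toMvPolynomial_mem _) l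
      set P := (l.map fun j => s (c (b j))).prod
      have hDX (i) : D (b j) (X i) ∈ listFiltration k X 2 := by
        simpa [D] using β.toMvPolynomial_mem _
      have e : Φ (((j :: l).map fun j => UniversalEnvelopingAlgebra.ι k (b j)).prod) 1 =
          ρ (b j) (Φ (l.map fun j => UniversalEnvelopingAlgebra.ι k (b j)).prod 1) := by
        rw [List.map_cons, List.prod_cons, map_mul, Module.End.mul_apply,
          UniversalEnvelopingAlgebra.lift_ι_apply]
      rw [e, List.map_cons, List.prod_cons]
      set Q := Φ (l.map fun j => UniversalEnvelopingAlgebra.ι k (b j)).prod 1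
      have hQ : Q ∈ listFiltration k X (l.length + 1) := by
        simpa using add_mem (listFiltration.mono (Nat.le_succ _) ih) hP
      rw [hρ, add_sub_assoc, ← mul_sub]
      exact add_mem ((D (b j)).mem_listFiltration hDX hQ)
        (listFiltration.mul_mem (β.toMvPolynomial_mem _) ih (by simp; omega))
  refine ⟨θ.toLinearMap ∘ₗ LinearMap.applyₗ 1 ∘ₗ Φ.toLinearMap, fun l => ?_⟩
  have := aeval_mem_listFiltration _ (fun i => b.toMvPolynomial_mem (π (β i))) (key l)
  have hl : θ (l.map fun j => s (c (b j))).prod = (l.map X).prod := by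
    rw [map_list_prod, List.map_map]
    congr 2
    funext j
    have : π (c (b j)) = b j := LinearMap.congr_fun hπ (b j)
    simp [hθ, this]
  rw [map_sub] at this
  change _ - θ _ ∈ _ at this
  rwa [hl] at this

end PBW

/-! ### Symbols of elements of a filtered algebra -/

section Symbol

open MvPolynomial

variable {k A J : Type*} [Field k] [Ring A] [Algebra k A]

theorem exists_mem_listFiltration {a : J → A} (h : Algebra.adjoin k (Set.range a) = ⊤) (u : A) :
    ∃ n, u ∈ listFiltration k a n := by
  have hu : u ∈ Algebra.adjoin k (Set.range a) := h ▸ Algebra.mem_top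
  induction hu using Algebra.adjoin_induction with
  | mem u hu => obtain ⟨j, rfl⟩ := hu; exact ⟨2, listFiltration.apply_mem j⟩
  | algebraMap c =>
    exact ⟨1, Algebra.algebraMap_eq_smul_one (A := A) c ▸
      Submodule.smul_mem _ c (listFiltration.one_mem one_pos)⟩
  | add u v _ _ hu hv =>
    obtain ⟨m, hm⟩ := hu
    obtain ⟨n, hn⟩ := hv
    exact ⟨max m n, add_mem (listFiltration.mono (le_max_left _ _) hm)
      (listFiltration.mono (le_max_right _ _) hn)⟩
  | mul u v _ _ hu hv =>
    obtain ⟨m, hm⟩ := hu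
    obtain ⟨n, hn⟩ := hv
    exact ⟨m + n, listFiltration.mul_mem hm hn (by omega)⟩

theorem MvPolynomial.list_prod_X_eq_monomial [DecidableEq J] (l : List J) :
    ((l.map X).prod : MvPolynomial J k) = monomial (Multiset.toFinsupp (l : Multiset J)) 1 := by
  induction l with
  | nil => simp
  | cons j l ih =>
    rw [List.map_cons, List.prod_cons, ih, X, monomial_mul, one_mul, ← Multiset.cons_coe,
      ← Multiset.singleton_add, map_add, Multiset.toFinsupp_singleton]

/-- The component of degree `n` of a linear map to a polynomial ring. -/
def symbol (Ψ : A →ₗ[k] MvPolynomial J k) (n : ℕ) : A →ₗ[k] MvPolynomial J k :=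
  homogeneousComponent n ∘ₗ Ψ

variable {a : J → A} {Ψ : A →ₗ[k] MvPolynomial J k}
  (hΨ : ∀ l : List J, Ψ (l.map a).prod - (l.map X).prod ∈ listFiltration k X l.length)

theorem homogeneousComponent_symbol (n : ℕ) (u : A) :
    homogeneousComponent n (symbol Ψ n u) = symbol Ψ n u := by
  rw [symbol, LinearMap.comp_apply,
    homogeneousComponent_of_mem (homogeneousComponent_mem n _), if_pos rfl]

include hΨ

theorem symbol_list_prod {l : List J} {n : ℕ} (h : l.length ≤ n) :
    symbol Ψ n (l.map a).prod = if l.length = n then (l.map X).prod else 0 := by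
  have h1 := homogeneousComponent_eq_zero_of_mem_listFiltration
    (listFiltration.mono h (hΨ l))
  rw [map_sub, sub_eq_zero, homogeneousComponent_list_prod_X] at h1
  rw [symbol, LinearMap.comp_apply, h1]
  simp only [eq_comm]

theorem symbol_list_prod_self (l : List J) :
    symbol Ψ l.length (l.map a).prod = (l.map X).prod := by
  rw [symbol_list_prod hΨ le_rfl, if_pos rfl]

theorem symbol_eq_zero {n : ℕ} {u : A} (hu : u ∈ listFiltration k a n) : symbol Ψ n u = 0 :=
  listFiltration.eqOn (g := 0)
    (fun l hl => by rw [symbol_list_prod hΨ hl.le, if_neg hl.ne, LinearMap.zero_apply]) hu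

theorem symbol_eq_of_sub_mem {n : ℕ} {u v : A} (h : u - v ∈ listFiltration k a n) :
    symbol Ψ n u = symbol Ψ n v := by
  rw [← sub_eq_zero, ← map_sub, symbol_eq_zero hΨ h]

theorem symbol_mul {m n : ℕ} {u v : A} (hu : u ∈ listFiltration k a (m + 1))
    (hv : v ∈ listFiltration k a (n + 1)) :
    symbol Ψ (m + n) (u * v) = symbol Ψ m u * symbol Ψ n v := by
  refine listFiltration.eqOn (f := symbol Ψ (m + n) ∘ₗ LinearMap.mulRight k v)
    (g := LinearMap.mulRight k (symbol Ψ n v) ∘ₗ symbol Ψ m) (fun l hl => ?_) hu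
  refine listFiltration.eqOn (f := symbol Ψ (m + n) ∘ₗ LinearMap.mulLeft k (l.map a).prod)
    (g := LinearMap.mulLeft k (symbol Ψ m (l.map a).prod) ∘ₗ symbol Ψ n) (fun l' hl' => ?_) hv
  have h := symbol_list_prod hΨ (l := l ++ l') (n := m + n) (by simp; omega)
  simp only [LinearMap.comp_apply, LinearMap.mulLeft_apply]
  rw [← List.prod_append, ← List.map_append, h, symbol_list_prod hΨ (Nat.lt_succ_iff.1 hl),
    symbol_list_prod hΨ (Nat.lt_succ_iff.1 hl')]
  by_cases h1 : l.length = m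
  · by_cases h2 : l'.length = n
    · simp [h1, h2]
    · rw [if_neg h2, mul_zero, if_neg (by simp; omega)]
  · rw [if_neg h1, zero_mul, if_neg (by simp; omega)]

theorem symbol_pow {u : A} (hu : u ∈ listFiltration k a 2) (n : ℕ) :
    symbol Ψ n (u ^ n) = symbol Ψ 1 u ^ n := by
  induction n with
  | zero => simpa using symbol_list_prod_self hΨ []
  | succ n ih => rw [pow_succ, symbol_mul hΨ (listFiltration.pow_mem hu n) hu, ih, pow_succ]

/-- The symbol is faithful on the graded pieces of the filtration. -/
theorem mem_listFiltration_of_symbol_eq_zero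
    (hc : ∀ i j, a i * a j - a j * a i ∈ listFiltration k a 2) {n : ℕ} {u : A}
    (hu : u ∈ listFiltration k a (n + 1)) (h : symbol Ψ n u = 0) : u ∈ listFiltration k a n := by
  classical
  -- `S` lifts a monomial to a product in an arbitrary order. The order matters only modulo lower
  -- terms, so `S` after the symbol is the identity modulo level n.
  let S : MvPolynomial J k →ₗ[k] A :=
    (basisMonomials J k).constr k fun m => (m.toMultiset.toList.map a).prod
  have key : listFiltration k a (n + 1) ≤
      (listFiltration k a n).comap (LinearMap.id - S ∘ₗ symbol Ψ n) := by
    refine listFiltration.le_iff.2 fun l hl => ?_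
    simp only [Submodule.mem_comap, LinearMap.sub_apply, LinearMap.id_apply, LinearMap.comp_apply]
    rw [symbol_list_prod hΨ (Nat.lt_succ_iff.1 hl)]
    split_ifs with h1
    · have h2 : S ((l.map X).prod) = (((l : Multiset J).toList).map a).prod := by
        rw [list_prod_X_eq_monomial]
        have := (basisMonomials J k).constr_basis k
          (fun m => (m.toMultiset.toList.map a).prod) (Multiset.toFinsupp (l : Multiset J))
        rwa [Multiset.toFinsupp_toMultiset, coe_basisMonomials] at this
      rw [h2, ← h1]
      exact listFiltration.prod_sub_prod_mem_of_perm hc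
        (Multiset.coe_eq_coe.1 (Multiset.coe_toList _).symm)
    · rw [map_zero, sub_zero]
      exact listFiltration.prod_mem (by omega)
  have := key hu
  simpa [h] using this

end Symbol

/-! ### Homogeneous components and p-th power substitution -/

section PolynomialSymbol

open MvPolynomial

variable {k J : Type*} [Field k]

theorem MvPolynomial.mem_listFiltration_of_homogeneousComponent_eq_zero {n : ℕ}
    {f : MvPolynomial J k} (hf : f ∈ listFiltration k X (n + 1))
    (h : homogeneousComponent n f = 0) : f ∈ listFiltration k X n :=
  mem_listFiltration_of_symbol_eq_zero (Ψ := LinearMap.id) (fun l => by simp)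
    (fun i j => by simp [mul_comm]) hf
    (by simpa [symbol] using h)

theorem MvPolynomial.exists_mem_listFiltration_X (f : MvPolynomial J k) :
    ∃ n, f ∈ listFiltration k X n :=
  exists_mem_listFiltration adjoin_range_X f

theorem MvPolynomial.homogeneousComponent_mem_listFiltration (n : ℕ) (f : MvPolynomial J k) :
    homogeneousComponent n f ∈ listFiltration k X (n + 1) := by
  obtain ⟨N, hN⟩ := exists_mem_listFiltration_X f
  refine (listFiltration.le_iff.2 fun l _ => ?_ : listFiltration k X N ≤
    (listFiltration k X (n + 1)).comap (homogeneousComponent n)) hN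
  rw [Submodule.mem_comap, homogeneousComponent_list_prod_X]
  split_ifs with h
  · exact listFiltration.prod_mem (by omega)
  · exact zero_mem _

theorem MvPolynomial.homogeneousComponent_expand {p : ℕ} (hp : 0 < p) (n : ℕ)
    (f : MvPolynomial J k) :
    homogeneousComponent n (expand p f) =
      if p ∣ n then expand p (homogeneousComponent (n / p) f) else 0 := by
  induction f using MvPolynomial.induction_on' with
  | monomial d r =>
    have h1 : (monomial (p • d) r).IsHomogeneous (p * d.degree) :=
      isHomogeneous_monomial r (by simp)
    rw [expand_monomial, homogeneousComponent_of_mem h1,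
      homogeneousComponent_of_mem (isHomogeneous_monomial r rfl)]
    by_cases h2 : p ∣ n
    · obtain ⟨m, rfl⟩ := h2
      rw [if_pos (dvd_mul_right p m), Nat.mul_div_cancel_left m hp]
      by_cases h3 : m = d.degree
      · rw [if_pos h3, if_pos (by rw [h3]), expand_monomial]
      · rw [if_neg h3, if_neg (mt (Nat.eq_of_mul_eq_mul_left hp) h3), map_zero]
    · rw [if_neg h2, if_neg (by rintro rfl; exact h2 (dvd_mul_right p _))]
  | add f g hf hg =>
    rw [map_add, map_add, map_add, map_add, hf, hg]
    split_ifs <;> simp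

end PolynomialSymbol

/-! ### Central elements whose symbols are the p-th powers of the variables -/

section Generators

open MvPolynomial

variable {k A J : Type*} [Field k] [Ring A] [Algebra k A] {a : J → A}
  {Ψ : A →ₗ[k] MvPolynomial J k}
  (hΨ : ∀ l : List J, Ψ (l.map a).prod - (l.map X).prod ∈ listFiltration k X l.length)
  {p : ℕ} {z : J → Subalgebra.center k A} (hz : ∀ j, (z j : A) - a j ^ p ∈ listFiltration k a p)

include hΨ hz

/-- Each `z j` has symbol X_j^p in degree p, and symbols are multiplicative, so substituting `z`
multiplies degrees by p and acts on leading forms as `expand p`. -/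
theorem symbol_aeval_center (hp : 0 < p) {n : ℕ} {q : MvPolynomial J k}
    (hq : q ∈ listFiltration k X (n + 1)) :
    (aeval z q : A) ∈ listFiltration k a (p * n + 1) ∧
      symbol Ψ (p * n) (aeval z q : A) = expand p (homogeneousComponent n q) := by
  have hzm (j) : (z j : A) ∈ listFiltration k a (p + 1) := by
    simpa using add_mem (listFiltration.mono (Nat.le_succ _) (hz j))
      (listFiltration.pow_mem (listFiltration.apply_mem j) p)
  have hzs (j) : symbol Ψ p (z j : A) = X j ^ p := by
    rw [symbol_eq_of_sub_mem hΨ (hz j), symbol_pow hΨ (listFiltration.apply_mem j)]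
    congr 1
    simpa using symbol_list_prod_self hΨ [j]
  have hl (l : List J) : ((l.map z).prod : A) ∈ listFiltration k a (p * l.length + 1) ∧
      symbol Ψ (p * l.length) ((l.map z).prod : A) = expand p (l.map X).prod := by
    induction l with
    | nil =>
      refine ⟨listFiltration.one_mem (by simp), ?_⟩
      simpa using symbol_list_prod_self hΨ []
    | cons j l ih =>
      have e : p * (j :: l).length = p + p * l.length := by simp; ring
      rw [e]
      simp only [List.map_cons, List.prod_cons, map_mul, MulMemClass.coe_mul, expand_X]
      exact ⟨listFiltration.mul_mem (hzm j) ih.1 (by omega), by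
        rw [symbol_mul hΨ (hzm j) ih.1, hzs, ih.2]⟩
  have hX (l : List J) : aeval z ((l.map X).prod : MvPolynomial J k) = (l.map z).prod := by
    simp [map_list_prod, Function.comp_def]
  let F : MvPolynomial J k →ₗ[k] A :=
    (Subalgebra.center k A).val.toLinearMap ∘ₗ (aeval z).toLinearMap
  constructor
  · refine (listFiltration.le_iff.2 fun l h => ?_ : listFiltration k X (n + 1) ≤
      (listFiltration k a (p * n + 1)).comap F) hq
    change (aeval z ((l.map X).prod : MvPolynomial J k) : A) ∈ listFiltration k a (p * n + 1)
    rw [hX]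
    exact listFiltration.mono (by gcongr; omega) (hl l).1
  · refine listFiltration.eqOn (f := symbol Ψ (p * n) ∘ₗ F)
      (g := (expand p).toLinearMap ∘ₗ homogeneousComponent n) (fun l h => ?_) hq
    change symbol Ψ (p * n) (aeval z ((l.map X).prod : MvPolynomial J k) : A) = expand p _
    rw [hX, homogeneousComponent_list_prod_X]
    split_ifs with h1
    · rw [h1, (hl l).2]
    · rw [map_zero]
      exact symbol_eq_zero hΨ (listFiltration.mono
        (show p * l.length + 1 ≤ p * n by nlinarith [show l.length + 1 ≤ n by omega]) (hl l).1)

/-- The leading form of a relation is killed by the injective map `expand p`, so the degree of a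
relation can be lowered until nothing is left. -/
theorem algebraicIndependent_center (hp : 0 < p) : AlgebraicIndependent k z := by
  rw [algebraicIndependent_iff_injective_aeval, injective_iff_map_eq_zero]
  intro q hq
  obtain ⟨n, hn⟩ := exists_mem_listFiltration_X q
  induction n with
  | zero => simpa [listFiltration.eq_bot] using hn
  | succ n ih =>
    refine ih (mem_listFiltration_of_homogeneousComponent_eq_zero hn ?_)
    have := (symbol_aeval_center hΨ hz hp hn).2
    rw [hq, ZeroMemClass.coe_zero, map_zero, eq_comm, expand_eq_zero hp] at this
    exact this

theorem adjoin_center_eq_top (hp : 0 < p) (ha : Algebra.adjoin k (Set.range a) = ⊤)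
    (hc : ∀ i j, a i * a j - a j * a i ∈ listFiltration k a 2)
    (hexp : ∀ u ∈ Subalgebra.center k A, ∀ n, u ∈ listFiltration k a (n + 1) →
      ∃ q, symbol Ψ n u = expand p q) :
    Algebra.adjoin k (Set.range z) = ⊤ := by
  refine eq_top_iff.2 fun ⟨u, hu⟩ _ => ?_
  obtain ⟨n, hn⟩ := exists_mem_listFiltration ha u
  induction n generalizing u with
  | zero =>
    rw [listFiltration.eq_bot, Submodule.mem_bot] at hn
    subst hn
    exact zero_mem _
  | succ n ih =>
    obtain ⟨q, hq⟩ := hexp u hu n hn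
    have h1 := homogeneousComponent_symbol (Ψ := Ψ) n u
    rw [hq, homogeneousComponent_expand hp] at h1
    -- The symbol is homogeneous of degree n and a polynomial in p-th powers. If p divides n, it is
    -- the symbol of a polynomial in `z`, which is subtracted; otherwise it is zero and `u` already
    -- has lower degree.
    split_ifs at h1 with hd
    · obtain ⟨m, rfl⟩ := hd
      rw [Nat.mul_div_cancel_left m hp] at h1
      set q' := homogeneousComponent m q
      have h2 := symbol_aeval_center hΨ hz hp (homogeneousComponent_mem_listFiltration m q)
      rw [homogeneousComponent_of_mem (homogeneousComponent_mem m q), if_pos rfl, h1, ← hq] at h2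
      have h3 := ih (u - (aeval z q' : A)) (sub_mem hu (aeval z q').2) trivial
        (mem_listFiltration_of_symbol_eq_zero hΨ hc (sub_mem hn h2.1)
          (by rw [map_sub, h2.2, sub_self]))
      have h4 : aeval z q' ∈ Algebra.adjoin k (Set.range z) :=
        Algebra.adjoin_range_eq_range_aeval k z ▸ ⟨q', rfl⟩
      convert add_mem h3 h4
      simp
    · exact ih u hu trivial (mem_listFiltration_of_symbol_eq_zero hΨ hc hn (by rw [hq, ← h1]))

end Generators

/-! ### Commutators become derivations on symbols -/

section DerivationSymbol

open MvPolynomial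

variable {k g J : Type*} [Field k] [LieRing g] [LieAlgebra k g] (b : Module.Basis J k g)

theorem UniversalEnvelopingAlgebra.ι_mem_listFiltration (x : g) :
    UniversalEnvelopingAlgebra.ι k x ∈
      listFiltration k (fun j => UniversalEnvelopingAlgebra.ι k (b j)) 2 := by
  have h := congrArg (UniversalEnvelopingAlgebra.ι k).toLinearMap (b.linearCombination_repr x)
  rw [Finsupp.linearCombination_apply, map_finsuppSum] at h
  simp only [map_smul, LieHom.coe_toLinearMap] at h
  rw [← h]
  exact listFiltration.sum_smul_mem _

theorem UniversalEnvelopingAlgebra.adjoin_range_ι_basis :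
    Algebra.adjoin k (Set.range fun j => UniversalEnvelopingAlgebra.ι k (b j)) = ⊤ := by
  rw [eq_top_iff, ← UniversalEnvelopingAlgebra.adjoin_range_ι]
  refine Algebra.adjoin_le ?_
  rintro _ ⟨x, rfl⟩
  have h := congrArg (UniversalEnvelopingAlgebra.ι k).toLinearMap (b.linearCombination_repr x)
  rw [Finsupp.linearCombination_apply, map_finsuppSum] at h
  simp only [map_smul, LieHom.coe_toLinearMap] at h
  rw [← h]
  exact Subalgebra.sum_mem _ fun j _ => Subalgebra.smul_mem _
    (Algebra.subset_adjoin (Set.mem_range_self j)) _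

variable {Ψ : UniversalEnvelopingAlgebra k g →ₗ[k] MvPolynomial J k}
  (hΨ : ∀ l : List J, Ψ (l.map fun j => UniversalEnvelopingAlgebra.ι k (b j)).prod -
    (l.map X).prod ∈ listFiltration k X l.length)

include hΨ

theorem symbol_ι (x : g) :
    symbol Ψ 1 (UniversalEnvelopingAlgebra.ι k x) = b.toMvPolynomial x := by
  have : symbol Ψ 1 ∘ₗ (UniversalEnvelopingAlgebra.ι k (L := g)).toLinearMap = b.toMvPolynomial :=
    b.ext fun j => by simpa using symbol_list_prod_self hΨ [j]
  exact LinearMap.congr_fun this x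

/-- The symbol turns the commutator with an element of the Lie algebra into the derivation of the
polynomial ring that extends its adjoint action. -/
theorem symbol_commutator (y : g) {n : ℕ} {u : UniversalEnvelopingAlgebra k g}
    (hu : u ∈ listFiltration k (fun j => UniversalEnvelopingAlgebra.ι k (b j)) (n + 1)) :
    symbol Ψ n (UniversalEnvelopingAlgebra.ι k y * u - u * UniversalEnvelopingAlgebra.ι k y) =
      b.derivation (LieAlgebra.ad k g y) (symbol Ψ n u) := by
  set a := fun j => UniversalEnvelopingAlgebra.ι k (b j)
  set v := UniversalEnvelopingAlgebra.ι k y with hv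
  have key (l : List J) : v * (l.map a).prod - (l.map a).prod * v ∈
      listFiltration k a (l.length + 1) ∧
      symbol Ψ l.length (v * (l.map a).prod - (l.map a).prod * v) =
        b.derivation (LieAlgebra.ad k g y) (l.map X).prod := by
    induction l with
    | nil => simp
    | cons j l ih =>
      have e : v * ((j :: l).map a).prod - ((j :: l).map a).prod * v =
          UniversalEnvelopingAlgebra.ι k ⁅y, b j⁆ * (l.map a).prod +
          a j * (v * (l.map a).prod - (l.map a).prod * v) := by
        rw [UniversalEnvelopingAlgebra.ι_lie, List.map_cons, List.prod_cons]
        simp only [a, ← hv, sub_mul, mul_sub, mul_assoc]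
        abel
      have h1 := UniversalEnvelopingAlgebra.ι_mem_listFiltration b ⁅y, b j⁆
      have h2 := listFiltration.prod_mem (k := k) (a := a) (lt_add_one l.length)
      have h3 := listFiltration.apply_mem (k := k) (a := a) j
      rw [e]
      refine ⟨add_mem (listFiltration.mul_mem h1 h2 (by simp; omega))
        (listFiltration.mul_mem h3 ih.1 (by simp; omega)), ?_⟩
      rw [List.length_cons, add_comm l.length, map_add, symbol_mul hΨ h1 h2, symbol_mul hΨ h3 ih.1,
        ih.2, symbol_ι b hΨ, symbol_list_prod_self hΨ, symbol_ι b hΨ]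
      simp only [List.map_cons, List.prod_cons, Derivation.leibniz, smul_eq_mul,
        Module.Basis.derivation_X, LieAlgebra.ad_apply, Module.Basis.toMvPolynomial_self]
      ring
  refine listFiltration.eqOn
    (f := symbol Ψ n ∘ₗ (LinearMap.mulLeft k v - LinearMap.mulRight k v))
    (g := (b.derivation (LieAlgebra.ad k g y)).toLinearMap ∘ₗ symbol Ψ n) (fun l hl => ?_) hu
  change symbol Ψ n (v * _ - _ * v) = b.derivation _ (symbol Ψ n _)
  rw [symbol_list_prod hΨ (Nat.lt_succ_iff.1 hl)]
  split_ifs with h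
  · rw [← h, (key l).2]
  · rw [map_zero]
    exact symbol_eq_zero hΨ (listFiltration.mono (by omega) (key l).1)

end DerivationSymbol

/-! ### Polynomials with vanishing partial derivatives -/

section Expand

open MvPolynomial

variable {k σ : Type*} [Field k]

theorem Derivation.apply_eq_sum_pderiv
    (D : Derivation k (MvPolynomial σ k) (MvPolynomial σ k)) (f : MvPolynomial σ k) :
    D f = ∑ j ∈ f.vars, pderiv j f * D (X j) := by
  classical
  have hsum (q) : (∑ j ∈ f.vars, D (X j) • pderiv j :
      Derivation k (MvPolynomial σ k) (MvPolynomial σ k)) q =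
      ∑ j ∈ f.vars, pderiv j q * D (X j) := by
    have := congrFun (map_sum Derivation.coeFnAddMonoidHom
      (fun j => (D (X j) • pderiv j : Derivation k (MvPolynomial σ k) (MvPolynomial σ k))) f.vars) q
    rw [Derivation.coeFnAddMonoidHom_apply, Finset.sum_apply] at this
    exact this.trans (Finset.sum_congr rfl fun j _ => mul_comm _ _)
  rw [← hsum]
  refine derivation_eq_of_forall_mem_vars fun i hi => ?_
  rw [hsum, Finset.sum_eq_single i]
  · simp
  · intro j _ hj
    simp [pderiv_X_of_ne hj.symm]
  · exact fun h => absurd hi h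

theorem MvPolynomial.exists_eq_expand_of_pderiv_eq_zero (p : ℕ) [CharP k p]
    {f : MvPolynomial σ k} (h : ∀ j, pderiv j f = 0) : ∃ q, f = expand p q := by
  -- The coefficient of ∂_j f at m - δ_j is m_j times that of f at m, so m_j vanishes in k.
  have hdvd (m) (hm : m ∈ f.support) (j : σ) : p ∣ m j := by
    rcases Nat.eq_zero_or_pos (m j) with h0 | h0
    · exact h0 ▸ dvd_zero p
    have h1 := congrArg (coeff (m - Finsupp.single j 1)) (h j)
    have h2 : m - Finsupp.single j 1 + Finsupp.single j 1 = m :=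
      tsub_add_cancel_of_le (Finsupp.single_le_iff.2 h0)
    rw [coeff_pderiv, coeff_zero, h2] at h1
    have h3 : ((m j : ℕ) : k) = 0 := by
      have h4 := (mul_eq_zero.1 h1).resolve_left (mem_support_iff.1 hm)
      rw [← Nat.cast_add_one, Finsupp.tsub_apply, Finsupp.single_eq_same,
        Nat.sub_add_cancel h0] at h4
      exact h4
    exact (CharP.cast_eq_zero_iff k p _).1 h3
  suffices f ∈ (expand (R := k) (σ := σ) p).range from let ⟨q, hq⟩ := this; ⟨q, hq.symm⟩
  rw [f.as_sum]
  refine sum_mem fun m hm => ⟨monomial (m.mapRange (· / p) (Nat.zero_div p)) (coeff m f), ?_⟩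
  rw [AlgHom.toRingHom_eq_coe, RingHom.coe_coe, expand_monomial]
  congr 2
  ext j
  simp [Nat.mul_div_cancel' (hdvd m hm j)]

end Expand

/-! ### Brackets and invariants of A ⊗ L -/

section TensorProduct

open MvPolynomial

variable {k L I R A : Type*} [Field k] [LieRing L] [LieAlgebra k L] [CommRing A] [Algebra k A]

theorem LieAlgebra.ad_tmul_tmul (a c : A) (x y : L) :
    LieAlgebra.ad k (A ⊗[k] L) (a ⊗ₜ x) (c ⊗ₜ y) = (a * c) ⊗ₜ ⁅x, y⁆ :=
  LieAlgebra.ExtendScalars.bracket_tmul k A L L a c x y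

theorem LieAlgebra.ad_tmul_pow_tmul (a c : A) (x y : L) (n : ℕ) :
    (LieAlgebra.ad k (A ⊗[k] L) (a ⊗ₜ x) ^ n) (c ⊗ₜ y) =
      (a ^ n * c) ⊗ₜ ((LieAlgebra.ad k L x ^ n) y) := by
  induction n with
  | zero => simp
  | succ n ih =>
    rw [pow_succ', Module.End.mul_apply, ih, LieAlgebra.ad_tmul_tmul, pow_succ' a, pow_succ',
      Module.End.mul_apply, LieAlgebra.ad_apply, mul_assoc]

variable (b : Module.Basis R k A) (e : Module.Basis I k L)

/-- The coordinate map `A ⊗ L → L` at a member of a basis of `A`. -/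
def tensorCoord (r : R) : A ⊗[k] L →ₗ[k] L :=
  TensorProduct.lid k L ∘ₗ (b.coord r).rTensor L

theorem tensorCoord_tmul (r : R) (a : A) (x : L) : tensorCoord b r (a ⊗ₜ x) = b.repr a r • x := by
  simp [tensorCoord]

theorem eq_zero_of_tensorCoord_eq_zero {y : A ⊗[k] L} (h : ∀ r, tensorCoord b r y = 0) :
    y = 0 := by
  classical
  refine (TensorProduct.equivFinsuppOfBasisLeft (N := L) b).map_eq_zero_iff.1 ?_
  ext r
  rw [Finsupp.zero_apply, ← h r]
  simp [TensorProduct.equivFinsuppOfBasisLeft_apply, tensorCoord]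

/-- The basis `e i ⊗ b r` of `A ⊗ L`. -/
def currentBasis : Module.Basis (I × R) k (A ⊗[k] L) :=
  (b.tensorProduct e).reindex (Equiv.prodComm R I)

@[simp]
theorem currentBasis_apply (j : I × R) : currentBasis b e j = b j.2 ⊗ₜ e j.1 := by
  rw [currentBasis, Module.Basis.reindex_apply]
  exact Module.Basis.tensorProduct_apply b e j.2 j.1

theorem currentBasis_coord (i : I) (r : R) (y : A ⊗[k] L) :
    (currentBasis b e).coord (i, r) y = e.coord i (tensorCoord b r y) := by
  classical
  have : (currentBasis b e).coord (i, r) = e.coord i ∘ₗ tensorCoord b r :=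
    (currentBasis b e).ext fun j => by
      rw [Module.Basis.coord_apply, Module.Basis.repr_self, currentBasis_apply]
      simp only [LinearMap.comp_apply, tensorCoord_tmul, Module.Basis.coord_apply,
        Module.Basis.repr_self, map_smul, Finsupp.single_apply, smul_eq_mul,
        Prod.ext_iff]
      split_ifs <;> simp_all
  exact LinearMap.congr_fun this y

theorem Module.Basis.pderiv_toMvPolynomial {M σ : Type*} [AddCommGroup M] [Module k M]
    (β : Module.Basis σ k M) (j : σ) (x : M) :
    pderiv j (β.toMvPolynomial x) = C (β.coord j x) := by
  classical
  have : (pderiv (R := k) j).toLinearMap ∘ₗ β.toMvPolynomial =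
      (Algebra.linearMap k (MvPolynomial σ k)) ∘ₗ β.coord j := β.ext fun i => by
    simp [pderiv_X, Finsupp.single_apply, Pi.single_apply, eq_comm]
  exact LinearMap.congr_fun this x

variable [Add R] [IsLeftCancelAdd R] (hb : ∀ r s, b (r + s) = b r * b s)

include hb in
-- By left cancellation, multiplication by `b s` shifts the coordinates without merging any two of
-- them.
theorem tensorCoord_lie (r s : R) (x : L) (y : A ⊗[k] L) :
    tensorCoord b (s + r) (LieAlgebra.ad k (A ⊗[k] L) (b s ⊗ₜ x) y) = ⁅x, tensorCoord b r y⁆ := by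
  classical
  have hmul (a : A) : b.repr (b s * a) (s + r) = b.repr a r := by
    have : (b.coord (s + r)) ∘ₗ LinearMap.mulLeft k (b s) = b.coord r := b.ext fun t => by
      simp [← hb, Finsupp.single_apply]
    exact LinearMap.congr_fun this a
  induction y using TensorProduct.induction_on with
  | zero => simp
  | add y z hy hz => rw [map_add, map_add, hy, hz, map_add, lie_add]
  | tmul a y => rw [LieAlgebra.ad_tmul_tmul, tensorCoord_tmul, tensorCoord_tmul, hmul, lie_smul]

include hb in
theorem ad_tensorProduct_injective (h : Function.Injective (LieAlgebra.ad k L)) :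
    Function.Injective (LieAlgebra.ad k (A ⊗[k] L)) := by
  rw [injective_iff_map_eq_zero]
  intro y hy
  refine eq_zero_of_tensorCoord_eq_zero b fun r => ?_
  refine (injective_iff_map_eq_zero _).1 h _ (LinearMap.ext fun x => ?_)
  have h1 := LinearMap.congr_fun hy (b r ⊗ₜ x)
  -- Any shift would do; `r` itself is at hand. A central `y` thus has central coordinates.
  have h2 := tensorCoord_lie b hb r r x y
  rw [LieAlgebra.ad_apply, ← lie_skew] at h2
  rw [LieAlgebra.ad_apply] at h1
  rw [h1] at h2
  rw [LieAlgebra.ad_apply, ← lie_skew, ← h2]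
  simp

include hb in
/-- The invariants of `A ⊗ L` in its symmetric algebra have zero partial derivatives, if the
center of `L` is trivial. -/
theorem pderiv_eq_zero_of_derivation_eq_zero (h : Function.Injective (LieAlgebra.ad k L))
    (hsep : ∀ (S : Finset R) (r : R), ∃ s, s + r ∉ S) {f : MvPolynomial (I × R) k}
    (hf : ∀ y, (currentBasis b e).derivation (LieAlgebra.ad k (A ⊗[k] L) y) f = 0) (j : I × R) :
    pderiv j f = 0 := by
  classical
  obtain ⟨i₀, r₀⟩ := j
  by_cases hj : (i₀, r₀) ∈ f.vars
  swap
  · exact pderiv_eq_zero_of_notMem_vars hj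
  -- Shifting by `s` sends the index r₀ to one that no variable of `f` has.
  obtain ⟨s, hs⟩ := hsep (f.vars.image Prod.snd) r₀
  let T := f.vars.filter fun j => j.2 = r₀
  have key (x : L) (l : I) : ∑ j ∈ T, C (e.coord l ⁅x, e j.1⁆) * pderiv j f = 0 := by
    let D := (currentBasis b e).derivation (LieAlgebra.ad k (A ⊗[k] L) (b s ⊗ₜ x))
    let v : I × R := (l, s + r₀)
    have hv : v ∉ f.vars := fun hv => hs (Finset.mem_image_of_mem Prod.snd hv)
    -- Both `D f` and the derivative by the absent variable `v` vanish. The commutator sends X_j to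
    -- the v-coordinate of the bracket with the j-th basis element, a constant that is zero unless j
    -- has second index r₀.
    have hE : ⁅pderiv (R := k) v, D⁆ f = 0 := by
      rw [Derivation.commutator_apply, hf, map_zero, pderiv_eq_zero_of_notMem_vars hv, map_zero,
        sub_zero]
    rw [Derivation.apply_eq_sum_pderiv] at hE
    rw [Finset.sum_filter]
    refine Eq.trans ?_ hE
    refine Finset.sum_congr rfl fun j _ => ?_
    have h1 : D (pderiv v (X j)) = 0 := by
      rw [pderiv_X]
      by_cases hvj : v = j
      · subst hvj; simp
      · rw [Pi.single_eq_of_ne (Ne.symm hvj), map_zero]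
    rw [Derivation.commutator_apply, h1, sub_zero, Module.Basis.derivation_X,
      Module.Basis.pderiv_toMvPolynomial, currentBasis_apply, currentBasis_coord,
      LieAlgebra.ad_tmul_tmul, tensorCoord_tmul, ← hb, Module.Basis.repr_self, map_smul,
      Finsupp.single_apply]
    by_cases hr : j.2 = r₀
    · simp [hr, mul_comm]
    · simp [hr]
  ext m
  rw [coeff_zero]
  -- For a fixed monomial `m`, `key` over all x and l says that this combination is central in L. It
  -- is therefore zero, and independence of `e` isolates the coefficient at i₀.
  have hw : ∑ j ∈ T, coeff m (pderiv j f) • e j.1 = 0 := by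
    refine (injective_iff_map_eq_zero _).1 h _ ?_
    refine LinearMap.ext fun x => e.ext_elem fun l => ?_
    have h1 := congrArg (coeff m) (key x l)
    simp only [coeff_sum, coeff_C_mul, coeff_zero, Module.Basis.coord_apply] at h1
    rw [LieAlgebra.ad_apply, ← lie_skew, lie_sum]
    simpa [mul_comm] using h1
  have hw2 := congrArg (fun w => e.repr w i₀) hw
  simp only [map_sum, map_smul, Module.Basis.repr_self, map_zero, Finsupp.finsetSum_apply,
    Finsupp.smul_apply, Finsupp.single_apply, Finsupp.zero_apply] at hw2
  rw [Finset.sum_eq_single (i₀, r₀)] at hw2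
  · simpa using hw2
  · rintro ⟨i, r⟩ hi hne
    have : r = r₀ := (Finset.mem_filter.1 hi).2
    subst this
    rw [if_neg (fun h => hne (by simpa using h)), smul_zero]
  · exact fun h => absurd (Finset.mem_filter.2 ⟨hj, rfl⟩ : (i₀, r₀) ∈ T) h

end TensorProduct

/-! ### The center of the enveloping algebra -/

section Center

open MvPolynomial

/-- The center of the enveloping algebra of a restricted Lie algebra with trivial center, provided
that the invariants in the symmetric algebra have zero partial derivatives. -/
theorem centerFreelyGeneratedBy_pCentralElement {k g J : Type*} [Field k] (p : ℕ) [Fact p.Prime]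
    [CharP k p] [LieRing g] [LieAlgebra k g] (h : Function.Injective (LieAlgebra.ad k g))
    (b : Module.Basis J k g)
    (hinv : ∀ f : MvPolynomial J k, (∀ y, b.derivation (LieAlgebra.ad k g y) f = 0) →
      ∀ j, pderiv j f = 0) (Q : RestrictedStructure k g p) :
    Subalgebra.center k (UniversalEnvelopingAlgebra k g) = pCenter Q ∧
      CenterFreelyGeneratedBy k fun j => pCentralElement Q (b j) := by
  have hp := (Fact.out : p.Prime)
  obtain ⟨Ψ, hΨ⟩ := UniversalEnvelopingAlgebra.exists_toMvPolynomial h b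
  let z (j : J) : Subalgebra.center k (UniversalEnvelopingAlgebra k g) :=
    ⟨pCentralElement Q (b j), pCentralElement_mem_center Q (b j)⟩
  have hz (j : J) : (z j : UniversalEnvelopingAlgebra k g) -
      UniversalEnvelopingAlgebra.ι k (b j) ^ p ∈
        listFiltration k (fun j => UniversalEnvelopingAlgebra.ι k (b j)) p := by
    change _ - _ - _ ∈ _
    rw [sub_sub_cancel_left]
    -- The correction term ι (x^[p]) has degree one, which is below p.
    exact neg_mem (listFiltration.mono hp.two_le
      (UniversalEnvelopingAlgebra.ι_mem_listFiltration b _))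
  have htop : Algebra.adjoin k (Set.range z) = ⊤ := by
    refine adjoin_center_eq_top hΨ hz hp.pos
      (UniversalEnvelopingAlgebra.adjoin_range_ι_basis b) (fun i j => ?_) fun u hu n hn => ?_
    · rw [← UniversalEnvelopingAlgebra.ι_lie]
      exact UniversalEnvelopingAlgebra.ι_mem_listFiltration b _
    · refine exists_eq_expand_of_pderiv_eq_zero p (hinv _ fun y => ?_)
      rw [← symbol_commutator b hΨ y hn, Subalgebra.mem_center_iff.1 hu, sub_self, map_zero]
  refine ⟨le_antisymm (fun u hu => ?_) ?_, z, fun j => rfl,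
    algebraicIndependent_center hΨ hz hp.pos, htop⟩
  · have hu' : (⟨u, hu⟩ : Subalgebra.center k (UniversalEnvelopingAlgebra k g)) ∈
        Algebra.adjoin k (Set.range z) := htop ▸ Algebra.mem_top
    have hmap : u ∈ (Algebra.adjoin k (Set.range z)).map
        (Subalgebra.center k (UniversalEnvelopingAlgebra k g)).val :=
      Subalgebra.mem_map.2 ⟨_, hu', rfl⟩
    rw [AlgHom.map_adjoin] at hmap
    refine Algebra.adjoin_mono ?_ hmap
    rintro _ ⟨_, ⟨j, rfl⟩, rfl⟩
    exact ⟨b j, rfl⟩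
  · refine Algebra.adjoin_le ?_
    rintro _ ⟨x, rfl⟩
    exact pCentralElement_mem_center Q x

/-- The restricted structure of `A ⊗ L` and the center of its enveloping algebra, for a commutative
algebra `A` with a basis that is closed under multiplication. -/
theorem center_enveloping_tensorProduct {k L I R A : Type*} [Field k] (p : ℕ) [Fact p.Prime]
    [CharP k p] [LieRing L] [LieAlgebra k L] [LieAlgebra.HasTrivialRadical k L]
    [CommRing A] [Algebra k A] (P : RestrictedStructure k L p) (e : Module.Basis I k L)
    [Add R] [IsLeftCancelAdd R] (b : Module.Basis R k A) (hb : ∀ r s, b (r + s) = b r * b s)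
    (hsep : ∀ (S : Finset R) (r : R), ∃ s, s + r ∉ S) :
    (∃! Q : RestrictedStructure k (A ⊗[k] L) p, ∀ (i : I) (r : R),
      Q.pow (b r ⊗ₜ[k] e i) = (b r ^ p) ⊗ₜ[k] P.pow (e i)) ∧
    ∀ Q : RestrictedStructure k (A ⊗[k] L) p,
      Subalgebra.center k (UniversalEnvelopingAlgebra k (A ⊗[k] L)) = pCenter Q ∧
      CenterFreelyGeneratedBy k fun ir : I × R => pCentralElement Q (b ir.2 ⊗ₜ[k] e ir.1) := by
  have hL : Function.Injective (LieAlgebra.ad k L) :=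
    LieAlgebra.ad_injective_of_hasTrivialRadical
  have hg := ad_tensorProduct_injective b hb hL
  have hpow (a : A) (x : L) : LieAlgebra.ad k (A ⊗[k] L) ((a ^ p) ⊗ₜ P.pow x) =
      LieAlgebra.ad k (A ⊗[k] L) (a ⊗ₜ x) ^ p := by
    refine TensorProduct.ext' fun c y => ?_
    rw [LieAlgebra.ad_tmul_tmul, LieAlgebra.ad_tmul_pow_tmul, ← P.ad_pow, LieAlgebra.ad_apply]
  refine ⟨?_, fun Q => ?_⟩
  · obtain ⟨Q⟩ := exists_restrictedStructure p hg _ (TensorProduct.span_tmul_eq_top k A L) (by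
      rintro _ ⟨a, x, rfl⟩
      exact ⟨_, hpow a x⟩)
    -- The values on the basis are forced: both sides have the same image under the injective `ad`.
    exact ⟨Q, fun i r => hg (by rw [Q.ad_pow, hpow]), fun Q' _ => Q'.eq_of_ad_injective hg Q⟩
  · have := centerFreelyGeneratedBy_pCentralElement p hg (currentBasis b e)
      (fun f hf => pderiv_eq_zero_of_derivation_eq_zero b e hb hL hsep hf) Q
    simpa only [currentBasis_apply] using this

end Center

end

theorem proposition4p1p3 {k L I : Type*} [Field k] [IsAlgClosed k]
    (p : ℕ) [Fact p.Prime] [CharP k p]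
    [LieRing L] [LieAlgebra k L] [LieAlgebra.HasTrivialRadical k L]
    (P : RestrictedStructure k L p) (e : Module.Basis I k L) :
    -- the current algebra
    ((∃! Q : RestrictedStructure k (k[X] ⊗[k] L) p, ∀ (i : I) (r : ℕ),
        Q.pow ((Polynomial.X ^ r : k[X]) ⊗ₜ[k] e i) =
          (Polynomial.X ^ (r * p) : k[X]) ⊗ₜ[k] P.pow (e i)) ∧
      ∀ Q : RestrictedStructure k (k[X] ⊗[k] L) p,
        (∀ (i : I) (r : ℕ), Q.pow ((Polynomial.X ^ r : k[X]) ⊗ₜ[k] e i) =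
          (Polynomial.X ^ (r * p) : k[X]) ⊗ₜ[k] P.pow (e i)) →
        Subalgebra.center k (UniversalEnvelopingAlgebra k (k[X] ⊗[k] L)) = pCenter Q ∧
        CenterFreelyGeneratedBy k
          (fun ir : I × ℕ => pCentralElement Q ((Polynomial.X ^ ir.2 : k[X]) ⊗ₜ[k] e ir.1))) ∧
    -- the loop algebra
    ((∃! Q : RestrictedStructure k (k[T;T⁻¹] ⊗[k] L) p, ∀ (i : I) (r : ℤ),
        Q.pow ((LaurentPolynomial.T r : k[T;T⁻¹]) ⊗ₜ[k] e i) =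
          (LaurentPolynomial.T (r * (p : ℤ)) : k[T;T⁻¹]) ⊗ₜ[k] P.pow (e i)) ∧
      ∀ Q : RestrictedStructure k (k[T;T⁻¹] ⊗[k] L) p,
        (∀ (i : I) (r : ℤ), Q.pow ((LaurentPolynomial.T r : k[T;T⁻¹]) ⊗ₜ[k] e i) =
          (LaurentPolynomial.T (r * (p : ℤ)) : k[T;T⁻¹]) ⊗ₜ[k] P.pow (e i)) →
        Subalgebra.center k (UniversalEnvelopingAlgebra k (k[T;T⁻¹] ⊗[k] L)) = pCenter Q ∧
        CenterFreelyGeneratedBy k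
          (fun ir : I × ℤ =>
            pCentralElement Q ((LaurentPolynomial.T ir.2 : k[T;T⁻¹]) ⊗ₜ[k] e ir.1))) := by
  constructor
  · have hX (r : ℕ) : Polynomial.basisMonomials k r = (Polynomial.X ^ r : k[X]) := by
      rw [Polynomial.coe_basisMonomials, Polynomial.X_pow_eq_monomial]
    have h := center_enveloping_tensorProduct p P e (Polynomial.basisMonomials k)
      (fun r s => by rw [hX, hX, hX, pow_add])
      -- A shift beyond the largest exponent in `S`; for Laurent polynomials below, any exponent
      -- outside `S` is reached by subtraction.
      fun S r => ⟨S.sup id + 1, fun hs => by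
        have := Finset.le_sup (f := id) hs
        simp only [id] at this
        omega⟩
    simp only [hX, ← pow_mul] at h
    exact ⟨h.1, fun Q _ => h.2 Q⟩
  · have hT (r : ℤ) : AddMonoidAlgebra.basis ℤ k r = (LaurentPolynomial.T r : k[T;T⁻¹]) := by
      rw [AddMonoidAlgebra.basis_apply, LaurentPolynomial.T]
    have h := center_enveloping_tensorProduct p P e (AddMonoidAlgebra.basis ℤ k)
      (fun r s => by rw [hT, hT, hT, LaurentPolynomial.T_add])
      fun S r => by
        obtain ⟨t, ht⟩ := Infinite.exists_notMem_finset S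
        exact ⟨t - r, by rwa [sub_add_cancel]⟩
    simp only [hT, LaurentPolynomial.T_pow, mul_comm (p : ℤ)] at h
    exact ⟨h.1, fun Q _ => h.2 Q⟩
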